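/- Let $\mathbb T$ be the unit circle with normalized Lebesgue measure, and let $L^\infty(\mathcal B(\ell^2))$ be the space of essentially bounded, weakly measurable functions $\Phi$ on $\mathbb T$ with values in the bounded linear operators on $\ell^2$ (functions that agree a.e. being identified), normed by $\|\Phi\|_{L^\infty}=\operatorname{ess\,sup}_{\zeta}\|\Phi(\zeta)\|$. Let $H^\infty(\mathcal B(\ell^2))\subset L^\infty(\mathcal B(\ell^2))$ be the subspace of (boundary values of) bounded analytic operator functions, i.e. those whose Fourier coefficients of negative index vanish, and let $H^2(\ell^2)\subset L^2(\ell^2)$ be the vector-valued Hardy space. With $\mathbb P_+$ the orthogonal projection of $L^2(\ell^2)$ onto $H^2(\ell^2)$, the Toeplitz operator $T_\Phi:H^2(\ell^2)\to H^2(\ell^2)$ is $T_\Phi f=\mathbb P_+(\Phi f)$. For an operator $A$ on $\ell^2$ and $j\ge 0$ let $s_j(A)=\inf\{\|A-K\|:\operatorname{rank}K\le j\}$. Put $$\Omega_0=\{F\in H^\infty(\mathcal B(\ell^2)) : F \text{ minimizes } \|\Phi-F\|_{L^\infty}\},$$ $$\Omega_j=\{F\in\Omega_{j-1} : F \text{ minimizes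 } \operatorname{ess\,sup}_{\zeta}s_j(\Phi(\zeta)-F(\zeta)) \text{ over } \Omega_{j-1}\},\quad j\ge 1.$$ The elements of $\Omega_0$ are the best approximants of $\Phi$, and $\Phi$ is called very badly approximable if the zero function belongs to $\bigcap_{j\ge0}\Omega_j$. **Theorem.** Let $\Phi\in L^\infty(\mathcal B(\ell^2))$ be such that $\Phi(\zeta)$ is an isometry for almost all $\zeta\in\mathbb T$, or $\Phi^*(\zeta)=\Phi(\zeta)^*$ is an isometry for almost all $\zeta\in\mathbb T$. Suppose that $\{f(\zeta):f\in\operatorname{Ker}T_\Phi\}$ is a dense subset of $(\operatorname{Ker}\Phi(\zeta))^\perp$ for almost all $\zeta\in\mathbb T$; that is, for every $f\in\operatorname{Ker}T_\Phi$ one has $f(\zeta)\in(\operatorname{Ker}\Phi(\zeta))^\perp$ for almost all $\zeta$, and there is a countable set $D\subset\operatorname{Ker}T_\Phi$ such that $\{f(\zeta):f\in D\}$ is dense in $(\operatorname{Ker}\Phi(\zeta))^\perp$ for almost all $\zeta$. Then $\Phi$ is very badly approximable, and the zero function is the only best approximant of $\Phi$. -/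

import Mathlib

open MeasureTheory
open scoped ENNReal

namespace OpApprox

noncomputable section

/-- The unit circle, parametrized by `t ↦ ζ = exp (2πit)`, `t ∈ ℝ/ℤ`. -/
abbrev Torus : Type := UnitAddCircle

/-- Normalized Lebesgue measure on the circle. -/
abbrev leb : Measure Torus := AddCircle.haarAddCircle

/-- The Hilbert space `ℓ²`. -/
abbrev Ell2 : Type := lp (fun _ : ℕ => ℂ) 2

/-- `L²(ℓ²)`. -/
abbrev L2 : Type := Lp Ell2 2 leb

/-- Operator-valued functions on the circle. -/
abbrev OpFun : Type := Torus → (Ell2 →L[ℂ] Ell2)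

/-- `Φ ∈ L^∞(B(ℓ²))`: weakly measurable and essentially bounded.
Functions that agree almost everywhere represent the same element. -/
structure MemLInf (Φ : OpFun) : Prop where
  weaklyMeasurable : ∀ x y : Ell2, AEMeasurable (fun ζ => inner ℂ y (Φ ζ x)) leb
  bounded : ∃ C : ℝ, ∀ᵐ ζ ∂leb, ‖Φ ζ‖ ≤ C

/-- `F ∈ H^∞(B(ℓ²))`, viewed on the circle: `F ∈ L^∞(B(ℓ²))` and all Fourier coefficients of
negative index vanish (in the weak sense, i.e. for all matrix entries `⟨F x, y⟩`). -/
structure MemHInf (F : OpFun) : Prop extends MemLInf F where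
  analytic : ∀ x y : Ell2, ∀ n : ℤ, n < 0 → fourierCoeff (fun ζ => inner ℂ y (F ζ x)) n = 0

/-- The norm `ess sup ‖Φ(ζ)‖`. -/
def linfNorm (Φ : OpFun) : ℝ≥0∞ := essSup (fun ζ => ENNReal.ofReal ‖Φ ζ‖) leb

/-- The singular value `s_j(A) = inf {‖A - K‖ : rank K ≤ j}`. -/
def singularValue (j : ℕ) (A : Ell2 →L[ℂ] Ell2) : ℝ :=
  sInf {r : ℝ | ∃ K : Ell2 →L[ℂ] Ell2, (K : Ell2 →ₗ[ℂ] Ell2).rank ≤ (j : Cardinal) ∧ r = ‖A - K‖}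

/-- `ess sup s_j(Φ(ζ))`. -/
def essSupSingularValue (j : ℕ) (Φ : OpFun) : ℝ≥0∞ :=
  essSup (fun ζ => ENNReal.ofReal (singularValue j (Φ ζ))) leb

/-- The nested sets `Ω_0 ⊇ Ω_1 ⊇ ...`: `Ω_0` is the set of best approximants of `Φ` in `H^∞`, and
`Ω_j` consists of the `F ∈ Ω_{j-1}` minimizing `ess sup s_j(Φ(ζ) - F(ζ))` over `Ω_{j-1}`. -/
def Omega (Φ : OpFun) : ℕ → Set OpFun
  | 0 => {F | MemHInf F ∧ ∀ G, MemHInf G → linfNorm (Φ - F) ≤ linfNorm (Φ - G)}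
  | j + 1 => {F | F ∈ Omega Φ j ∧ ∀ G ∈ Omega Φ j,
      essSupSingularValue (j + 1) (Φ - F) ≤ essSupSingularValue (j + 1) (Φ - G)}

/-- `F` is a best approximant of `Φ` by bounded analytic operator functions. -/
def IsBestApproximant (Φ F : OpFun) : Prop := F ∈ Omega Φ 0

/-- `F` is a superoptimal approximant of `Φ` by bounded analytic operator functions. -/
def IsSuperoptimalApproximant (Φ F : OpFun) : Prop := F ∈ ⋂ j, Omega Φ j

/-- `Φ` is very badly approximable: the zero function is a superoptimal approximant. -/
def VeryBadlyApproximable (Φ : OpFun) : Prop := IsSuperoptimalApproximant Φ 0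

/-! ### The Hardy space `H²(ℓ²)` and Toeplitz operators -/

lemma norm_fourierCoeff_le (f : L2) (n : ℤ) : ‖fourierCoeff (f : Torus → Ell2) n‖ ≤ ‖f‖ := by
  have h1 : MemLp (f : Torus → Ell2) 1 leb := (Lp.memLp f).mono_exponent (by norm_num)
  have h2 : ‖fourierCoeff (f : Torus → Ell2) n‖ ≤ ∫ t, ‖f t‖ ∂leb := by
    refine (norm_integral_le_integral_norm _).trans (le_of_eq ?_)
    refine integral_congr_ae (Filter.Eventually.of_forall fun t => ?_)
    change ‖fourier (-n) t • f t‖ = ‖f t‖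
    rw [norm_smul, fourier_apply, Circle.norm_coe, one_mul]
  refine h2.trans ?_
  have h3 : ∫ t, ‖f t‖ ∂leb = (eLpNorm f 1 leb).toReal := by
    rw [integral_norm_eq_lintegral_enorm h1.1, eLpNorm_one_eq_lintegral_enorm]
  rw [h3, Lp.norm_def]
  exact ENNReal.toReal_mono (Lp.memLp f).eLpNorm_ne_top
    (eLpNorm_le_eLpNorm_of_exponent_le (by norm_num) (Lp.memLp f).1)

/-- The `n`-th Fourier coefficient as a continuous linear map on `L²(ℓ²)`. -/
def fourierCoeffL (n : ℤ) : L2 →L[ℂ] Ell2 :=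
  LinearMap.mkContinuous
    { toFun := fun f => fourierCoeff (f : Torus → Ell2) n
      map_add' := fun f g => by
        have hf : Integrable (f : Torus → Ell2) leb := (Lp.memLp f).integrable (by norm_num)
        have hg : Integrable (g : Torus → Ell2) leb := (Lp.memLp g).integrable (by norm_num)
        rw [fourierCoeff_congr_ae (Lp.coeFn_add f g), fourierCoeff.add hf hg]
        rfl
      map_smul' := fun c f => by
        rw [fourierCoeff_congr_ae (Lp.coeFn_smul c f), fourierCoeff.const_smul]
        rfl }
    1 (fun f => by simpa using norm_fourierCoeff_le f n)

/-- The Hardy space `H²(ℓ²) ⊆ L²(ℓ²)`: all Fourier coefficients of negative index vanish. -/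
def H2 : Submodule ℂ L2 where
  carrier := {f | ∀ n : ℤ, n < 0 → fourierCoeff (f : Torus → Ell2) n = 0}
  add_mem' := fun {f g} hf hg n hn => by
    have h := (fourierCoeffL n).map_add f g
    change fourierCoeff ((f + g : L2) : Torus → Ell2) n = fourierCoeff (f : Torus → Ell2) n +
      fourierCoeff (g : Torus → Ell2) n at h
    rw [h, hf n hn, hg n hn, add_zero]
  zero_mem' := fun n _ => (fourierCoeffL n).map_zero
  smul_mem' := fun c f hf n hn => by
    have h := (fourierCoeffL n).map_smul c f
    change fourierCoeff ((c • f : L2) : Torus → Ell2) n =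
      c • fourierCoeff (f : Torus → Ell2) n at h
    rw [h, hf n hn, smul_zero]

lemma isClosed_H2 : IsClosed (H2 : Set L2) := by
  have h : (H2 : Set L2) = ⋂ n : ℤ, ⋂ _ : n < 0, {f | fourierCoeffL n f = 0} := by
    ext f
    simp only [Set.mem_iInter, Set.mem_ofPred_eq]
    exact Iff.rfl
  rw [h]
  exact isClosed_iInter fun n => isClosed_iInter fun _ =>
    isClosed_eq (fourierCoeffL n).continuous continuous_const

instance : CompleteSpace H2 := isClosed_H2.completeSpace_coe

lemma aestronglyMeasurable_of_coord {g : Torus → Ell2}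
    (hg : ∀ i, AEStronglyMeasurable (fun ζ => g ζ i) leb) : AEStronglyMeasurable g leb := by
  refine aestronglyMeasurable_of_tendsto_ae (u := Filter.atTop)
    (f := fun (N : ℕ) ζ => ∑ i ∈ Finset.range N, lp.single 2 i (g ζ i)) ?_ ?_
  · intro N
    refine Finset.aestronglyMeasurable_fun_sum _ fun i _ => ?_
    have hc : Continuous (fun c : ℂ => (lp.single 2 i c : Ell2)) :=
      (lp.isometry_single (E := fun _ : ℕ => ℂ) (p := 2) i).continuous
    exact hc.comp_aestronglyMeasurable (hg i)
  · exact Filter.Eventually.of_forall fun ζ =>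
      (lp.hasSum_single (by norm_num) (g ζ)).tendsto_sum_nat

lemma coord_eq_inner (v : Ell2) (i : ℕ) : v i = inner ℂ (lp.single 2 i (1 : ℂ) : Ell2) v := by
  rw [lp.inner_single_left]
  simp

/-- Multiplication by a weakly measurable function preserves measurability. -/
lemma MemLInf.aestronglyMeasurable_mul {Φ : OpFun} (hΦ : MemLInf Φ) {f : Torus → Ell2}
    (hf : AEStronglyMeasurable f leb) : AEStronglyMeasurable (fun ζ => Φ ζ (f ζ)) leb := by
  refine aestronglyMeasurable_of_coord fun i => ?_
  refine aestronglyMeasurable_of_tendsto_ae (u := Filter.atTop)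
    (f := fun (N : ℕ) ζ => ∑ j ∈ Finset.range N,
      inner ℂ (lp.single 2 j (1 : ℂ) : Ell2) (f ζ) *
        inner ℂ (lp.single 2 i (1 : ℂ) : Ell2) (Φ ζ (lp.single 2 j (1 : ℂ)))) ?_ ?_
  · intro N
    refine Finset.aestronglyMeasurable_fun_sum _ fun j _ => ?_
    exact (aestronglyMeasurable_const.inner hf).mul
      (hΦ.weaklyMeasurable _ _).aestronglyMeasurable
  · refine Filter.Eventually.of_forall fun ζ => ?_
    have h := (((lp.hasSum_single (by norm_num) (f ζ)).mapL (Φ ζ)).mapL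
      (innerSL ℂ (lp.single 2 i (1 : ℂ) : Ell2))).tendsto_sum_nat
    rw [coord_eq_inner]
    refine h.congr fun N => Finset.sum_congr rfl fun j _ => ?_
    have hs : (lp.single 2 j (f ζ j) : Ell2) = (f ζ j) • lp.single 2 j (1 : ℂ) := by
      rw [← lp.single_smul, smul_eq_mul, mul_one]
    rw [hs, map_smul, map_smul, ← coord_eq_inner (f ζ) j]
    rfl

lemma MemLInf.memLp_mul {Φ : OpFun} (hΦ : MemLInf Φ) (f : L2) :
    MemLp (fun ζ => Φ ζ (f ζ)) 2 leb := by
  obtain ⟨C, hC⟩ := hΦ.bounded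
  refine MemLp.of_le_mul (c := C) (Lp.memLp f)
    (hΦ.aestronglyMeasurable_mul (Lp.memLp f).1) ?_
  filter_upwards [hC] with ζ h
  exact (Φ ζ).le_of_opNorm_le h _

/-- The multiplication operator `f ↦ Φ f` on `L²(ℓ²)`, `(Φ f)(ζ) = Φ(ζ) f(ζ)`. -/
def mulOp {Φ : OpFun} (hΦ : MemLInf Φ) : L2 →L[ℂ] L2 :=
  LinearMap.mkContinuousOfExistsBound
    { toFun := fun f => (hΦ.memLp_mul f).toLp _
      map_add' := fun f g => by
        rw [← MemLp.toLp_add, MemLp.toLp_eq_toLp_iff]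
        filter_upwards [Lp.coeFn_add f g] with ζ h
        change Φ ζ (((f + g : L2) : Torus → Ell2) ζ) = Φ ζ (f ζ) + Φ ζ (g ζ)
        rw [h, Pi.add_apply, map_add]
      map_smul' := fun c f => by
        rw [RingHom.id_apply, ← MemLp.toLp_const_smul, MemLp.toLp_eq_toLp_iff]
        filter_upwards [Lp.coeFn_smul c f] with ζ h
        change Φ ζ (((c • f : L2) : Torus → Ell2) ζ) = c • Φ ζ (f ζ)
        rw [h, Pi.smul_apply, map_smul] }
    (by
      obtain ⟨C, hC⟩ := hΦ.bounded
      refine ⟨C, fun f => Lp.norm_le_mul_norm_of_ae_le_mul ?_⟩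
      filter_upwards [hC, (hΦ.memLp_mul f).coeFn_toLp] with ζ h h'
      change ‖((hΦ.memLp_mul f).toLp _ : Torus → Ell2) ζ‖ ≤ _
      rw [h']
      exact (Φ ζ).le_of_opNorm_le h _)

/-- The Toeplitz operator `T_Φ : H²(ℓ²) → H²(ℓ²)`, `T_Φ f = P₊(Φ f)`. -/
def toeplitz {Φ : OpFun} (hΦ : MemLInf Φ) : H2 →L[ℂ] H2 :=
  H2.orthogonalProjectionOnto ∘L mulOp hΦ ∘L H2.subtypeL

/-- The values `{f(ζ) : f ∈ S}` form a dense subset of `E(ζ)` for almost all `ζ`.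
Since an element of `H²(ℓ²)` is determined only up to a null set, this is read in the usual way for
measurable families: every `f ∈ S` takes its values in `E(ζ)` almost everywhere, and the values of
countably many members of `S` are dense in `E(ζ)` almost everywhere. -/
def HasDenseValues (S : Submodule ℂ H2) (E : Torus → Submodule ℂ Ell2) : Prop :=
  (∀ f ∈ S, ∀ᵐ ζ ∂leb, (f : L2) ζ ∈ E ζ) ∧
    ∃ D : Set H2, D.Countable ∧ D ⊆ S ∧
      ∀ᵐ ζ ∂leb, (E ζ : Set Ell2) ⊆ closure ((fun f : H2 => (f : L2) ζ) '' D)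

end

end OpApprox

/-! Let `F` be bounded analytic with `‖Φ - F‖ ≤ 1`, and let `f ∈ Ker T_Φ`. Then `Φ f ⟂ H²` while `F
f ∈ H²`, so `‖(Φ - F) f‖² = ‖Φ f‖² + ‖F f‖²`. The left side is at most `‖f‖²`, and `‖Φ f‖ = ‖f‖`
because `f(ζ) ⟂ Ker Φ(ζ)`; hence `F f = 0` (`MemHInf.apply_eq_zero_of_mem_ker`). By density `F(ζ)`
vanishes on `(Ker Φ(ζ))ᗮ`.

What remains is pointwise (`eq_zero_of_norm_sub_le_one`). If `Φ(ζ)` is an isometry, its kernel is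
trivial. If it is a co-isometry, it already maps `(Ker Φ(ζ))ᗮ` isometrically onto the whole space,
so a contraction agreeing with it there must vanish on the kernel. Thus zero is the only bounded
analytic function within distance one, so it is the unique best approximant, and every later
minimization is trivial. -/

namespace OpApprox

/-! ### Multiplication by bounded analytic functions on the Hardy space -/

/-- The product of two scalar `H²` functions has vanishing Fourier coefficients of negative
index. -/
lemma fourierCoeff_mul_eq_zero {g h : Torus → ℂ} (hg : MemLp g 2 leb) (hh : MemLp h 2 leb)
    (hg0 : ∀ n : ℤ, n < 0 → fourierCoeff g n = 0) (hh0 : ∀ n : ℤ, n < 0 → fourierCoeff h n = 0)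
    {n : ℤ} (hn : n < 0) : fourierCoeff (fun ζ => g ζ * h ζ) n = 0 := by
  -- Conjugating turns the `n`-th coefficient of `g h` into an inner product, which Parseval expands
  -- as `∑ ĝ(n - k) ĥ(k)`. Since `n < 0`, either `k < 0` or `n - k < 0`.
  have hu : MemLp (fun ζ => star (fourier (-n) ζ * g ζ)) 2 leb := by
    refine MemLp.of_le hg ?_ (Filter.Eventually.of_forall fun ζ => ?_)
    · exact continuous_star.comp_aestronglyMeasurable
        ((fourier (-n)).continuous.aestronglyMeasurable.mul hg.1)
    · rw [norm_star, norm_mul, fourier_apply, Circle.norm_coe, one_mul]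
  have key := (fourierBasis (T := 1)).tsum_inner_mul_inner (hu.toLp _) (hh.toLp _)
  have hterm : ∀ k : ℤ, inner ℂ (hu.toLp _) (fourierBasis (T := 1) k) *
      inner ℂ (fourierBasis (T := 1) k) (hh.toLp _) = 0 := by
    intro k
    rw [← HilbertBasis.repr_apply_apply, fourierBasis_repr,
      ← inner_conj_symm, ← HilbertBasis.repr_apply_apply, fourierBasis_repr,
      fourierCoeff_congr_ae hu.coeFn_toLp, fourierCoeff_congr_ae hh.coeFn_toLp]
    rcases lt_or_ge k 0 with hk | hk
    · rw [hh0 k hk, mul_zero]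
    · have h1 : fourierCoeff (fun ζ => star (fourier (-n) ζ * g ζ)) k =
          star (fourierCoeff g (n - k)) := by
        unfold fourierCoeff
        change _ = (starRingEnd ℂ) _
        rw [← integral_conj]
        refine integral_congr_ae (Filter.Eventually.of_forall fun ζ => ?_)
        have e : (-(n - k) : ℤ) = k + -n := by ring
        simp only [smul_eq_mul, e, fourier_add, map_mul, fourier_neg, ← starRingEnd_apply]
        ring
      rw [h1, hg0 _ (by omega), star_zero, map_zero, zero_mul]
  rw [tsum_congr hterm, tsum_zero, L2.inner_def] at key
  unfold fourierCoeff
  rw [key]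
  refine integral_congr_ae ?_
  filter_upwards [hu.coeFn_toLp, hh.coeFn_toLp] with ζ h1 h2
  rw [h1, h2]
  simp only [RCLike.inner_apply, smul_eq_mul, ← starRingEnd_apply, RingHomCompTriple.comp_apply,
    RingHom.id_apply]
  ring

/-- Gives a dominating function uniform in the truncation level. -/
lemma norm_sum_range_single_le (v : Ell2) (N : ℕ) :
    ‖(∑ j ∈ Finset.range N, lp.single 2 j (v j) : Ell2)‖ ≤ ‖v‖ := by
  have h0 : (0 : ℝ) < (2 : ℝ≥0∞).toReal := by norm_num
  have h1 := lp.norm_sum_single (E := fun _ : ℕ => ℂ) (p := 2) h0 v (Finset.range N)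
  have h2 := lp.sum_rpow_le_norm_rpow (E := fun _ : ℕ => ℂ) (p := 2) h0 v (Finset.range N)
  rw [← h1] at h2
  exact (Real.rpow_le_rpow_iff (norm_nonneg _) (norm_nonneg _) h0).1 h2

lemma inner_fourierCoeff (x : Ell2) {f : Torus → Ell2} (hf : Integrable f leb) (n : ℤ) :
    inner ℂ x (fourierCoeff f n) = fourierCoeff (fun ζ => inner ℂ x (f ζ)) n := by
  unfold fourierCoeff
  rw [← integral_inner]
  · simp only [inner_smul_right, smul_eq_mul]
  · refine hf.mono ((fourier (-n)).continuous.aestronglyMeasurable.smul hf.1)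
      (Filter.Eventually.of_forall fun ζ => ?_)
    rw [norm_smul, fourier_apply, Circle.norm_coe, one_mul]

lemma MemLInf.memLp_entry {F : OpFun} (hF : MemLInf F) (x y : Ell2) :
    MemLp (fun ζ => inner ℂ y (F ζ x)) 2 leb := by
  obtain ⟨C, hC⟩ := hF.bounded
  refine MemLp.of_bound (hF.weaklyMeasurable x y).aestronglyMeasurable (‖y‖ * (C * ‖x‖)) ?_
  filter_upwards [hC] with ζ h
  refine (norm_inner_le_norm _ _).trans ?_
  gcongr
  exact (F ζ).le_of_opNorm_le h x

/-- Multiplication by a bounded analytic operator function preserves the Hardy space. -/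
lemma MemHInf.mulOp_mem_H2 {F : OpFun} (hF : MemHInf F) {f : L2} (hf : f ∈ H2) :
    mulOp hF.toMemLInf f ∈ H2 := by
  intro n hn
  have hFf := hF.toMemLInf.memLp_mul f
  have hcoe : (mulOp hF.toMemLInf f : Torus → Ell2) =ᵐ[leb] fun ζ => F ζ (f ζ) := hFf.coeFn_toLp
  have hfi : Integrable (f : Torus → Ell2) leb := (Lp.memLp f).integrable (by norm_num)
  rw [fourierCoeff_congr_ae hcoe]
  refine ext_inner_left ℂ fun x => ?_
  rw [inner_zero_right, inner_fourierCoeff x (hFf.integrable (by norm_num))]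
  obtain ⟨C, hC⟩ := hF.bounded
  have hcoord : ∀ j : ℕ, MemLp (fun ζ => f ζ j) 2 leb := fun j =>
    MemLp.of_le (Lp.memLp f)
      (by
        simp only [coord_eq_inner]
        exact aestronglyMeasurable_const.inner (Lp.memLp f).1)
      (Filter.Eventually.of_forall fun ζ => lp.norm_apply_le_norm (by norm_num) (f ζ) j)
  have hcoord0 : ∀ j : ℕ, ∀ m : ℤ, m < 0 → fourierCoeff (fun ζ => f ζ j) m = 0 := by
    intro j m hm
    simp only [coord_eq_inner]
    rw [← inner_fourierCoeff _ hfi, hf m hm, inner_zero_right]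
  -- Truncating `f` to `N` coordinates makes the entry of `F f` a finite sum of scalar `H²`
  -- products; dominated convergence then removes the truncation.
  let p : ℕ → Torus → ℂ := fun N ζ =>
    ∑ j ∈ Finset.range N, inner ℂ x (F ζ (lp.single 2 j (1 : ℂ))) * f ζ j
  have hp : ∀ N ζ, p N ζ = inner ℂ x (F ζ (∑ j ∈ Finset.range N, lp.single 2 j (f ζ j))) := by
    intro N ζ
    rw [map_sum, inner_sum]
    refine Finset.sum_congr rfl fun j _ => ?_
    have hs : (lp.single 2 j (f ζ j) : Ell2) = (f ζ j) • lp.single 2 j (1 : ℂ) := by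
      rw [← lp.single_smul, smul_eq_mul, mul_one]
    rw [hs, map_smul, inner_smul_right, mul_comm]
  have hp0 : ∀ N, fourierCoeff (p N) n = 0 := by
    intro N
    have hi : ∀ j ∈ Finset.range N, Integrable (fun ζ => fourier (-n) ζ •
        (inner ℂ x (F ζ (lp.single 2 j (1 : ℂ))) * f ζ j)) leb := by
      intro j _
      have h := (hF.toMemLInf.memLp_entry (lp.single 2 j (1 : ℂ)) x).integrable_mul (hcoord j)
      refine h.mono ((fourier (-n)).continuous.aestronglyMeasurable.smul h.1)
        (Filter.Eventually.of_forall fun ζ => ?_)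
      rw [norm_smul, fourier_apply, Circle.norm_coe, one_mul]
      rfl
    unfold fourierCoeff
    simp only [p, Finset.smul_sum]
    rw [integral_finsetSum _ hi]
    exact Finset.sum_eq_zero fun j _ =>
      fourierCoeff_mul_eq_zero (hF.toMemLInf.memLp_entry _ x) (hcoord j)
        (hF.analytic _ x) (hcoord0 j) hn
  have hlim : Filter.Tendsto (fun N => fourierCoeff (p N) n) Filter.atTop
      (nhds (fourierCoeff (fun ζ => inner ℂ x (F ζ (f ζ))) n)) := by
    refine tendsto_integral_of_dominated_convergence (fun ζ => ‖x‖ * (C * ‖f ζ‖)) ?_ ?_ ?_ ?_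
    · intro N
      refine (fourier (-n)).continuous.aestronglyMeasurable.smul ?_
      exact Finset.aestronglyMeasurable_fun_sum _ fun j _ =>
        (hF.weaklyMeasurable _ _).aestronglyMeasurable.mul (hcoord j).1
    · exact (hfi.norm.const_mul C).const_mul ‖x‖
    · intro N
      filter_upwards [hC] with ζ h
      rw [norm_smul, fourier_apply, Circle.norm_coe, one_mul, hp]
      refine (norm_inner_le_norm _ _).trans ?_
      have hC0 : 0 ≤ C := (norm_nonneg _).trans h
      gcongr
      refine ((F ζ).le_of_opNorm_le h _).trans ?_
      gcongr
      exact norm_sum_range_single_le _ _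
    · refine Filter.Eventually.of_forall fun ζ => ?_
      simp only [hp]
      refine Filter.Tendsto.const_smul ?_ _
      have h := (lp.hasSum_single (p := 2) (by norm_num) (f ζ)).tendsto_sum_nat
      exact ((continuous_const.inner (F ζ).continuous).tendsto (f ζ)).comp h
  simp only [hp0] at hlim
  exact (tendsto_nhds_unique hlim tendsto_const_nhds)

/-! ### Orthogonality along the kernel of the Toeplitz operator -/

/-- A best approximation to a symbol that is isometric along `f ∈ Ker T_Φ` annihilates `f`. -/
lemma MemHInf.apply_eq_zero_of_mem_ker {Φ F : OpFun} (hΦ : MemLInf Φ) (hF : MemHInf F)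
    (hle : ∀ᵐ ζ ∂leb, ‖Φ ζ - F ζ‖ ≤ 1) {f : H2} (hf : toeplitz hΦ f = 0)
    (hnorm : ∀ᵐ ζ ∂leb, ‖Φ ζ ((f : L2) ζ)‖ = ‖(f : L2) ζ‖) :
    ∀ᵐ ζ ∂leb, F ζ ((f : L2) ζ) = 0 := by
  set u := mulOp hΦ f with hu
  set v := mulOp hF.toMemLInf f with hv
  have hucoe : (u : Torus → Ell2) =ᵐ[leb] fun ζ => Φ ζ ((f : L2) ζ) :=
    (hΦ.memLp_mul f).coeFn_toLp
  have hvcoe : (v : Torus → Ell2) =ᵐ[leb] fun ζ => F ζ ((f : L2) ζ) :=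
    (hF.toMemLInf.memLp_mul f).coeFn_toLp
  have hvu : inner ℂ v u = (0 : ℂ) :=
    (Submodule.mem_orthogonal H2 u).1 (Submodule.orthogonalProjectionOnto_eq_zero_iff.1 hf) v
      (hF.mulOp_mem_H2 f.2)
  have huv : inner ℂ u v = (0 : ℂ) := inner_eq_zero_symm.1 hvu
  have hpyth : ‖u - v‖ * ‖u - v‖ = ‖u‖ * ‖u‖ + ‖v‖ * ‖v‖ := by
    have h := norm_add_sq_eq_norm_sq_add_norm_sq_of_inner_eq_zero (𝕜 := ℂ) u (-v)
      (by rw [inner_neg_right, huv, neg_zero])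
    rwa [← sub_eq_add_neg, norm_neg] at h
  have h1 : ‖u - v‖ ≤ ‖(f : L2)‖ := by
    refine Lp.norm_le_norm_of_ae_le ?_
    filter_upwards [hucoe, hvcoe, Lp.coeFn_sub u v, hle] with ζ a b c d
    rw [c, Pi.sub_apply, a, b, ← sub_apply]
    simpa using (Φ ζ - F ζ).le_of_opNorm_le d ((f : L2) ζ)
  have h2 : ‖(f : L2)‖ ≤ ‖u‖ := by
    refine Lp.norm_le_norm_of_ae_le ?_
    filter_upwards [hucoe, hnorm] with ζ a b
    rw [a, b]
  -- `‖u‖² + ‖v‖² = ‖u - v‖² ≤ ‖f‖² ≤ ‖u‖²`.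
  have hv0 : v = 0 := by
    rw [← norm_eq_zero]
    have := norm_nonneg (u - v)
    nlinarith [norm_nonneg v, norm_nonneg u]
  rw [hv0] at hvcoe
  filter_upwards [hvcoe, Lp.coeFn_zero Ell2 2 leb] with ζ a b
  rw [← a, b, Pi.zero_apply]

/-! ### Isometries and co-isometries of a Hilbert space -/

section Isometry

variable {E : Type*} [NormedAddCommGroup E] [InnerProductSpace ℂ E] [CompleteSpace E]

lemma apply_adjoint_of_isometry_adjoint {A : E →L[ℂ] E}
    (hA : Isometry (ContinuousLinearMap.adjoint A)) (y : E) :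
    A (ContinuousLinearMap.adjoint A y) = y := by
  have h := (ContinuousLinearMap.norm_map_iff_adjoint_comp_self
    (ContinuousLinearMap.adjoint A)).1
    (fun x => by simpa using hA.norm_map_of_map_zero (map_zero _) x)
  rw [ContinuousLinearMap.adjoint_adjoint] at h
  exact DFunLike.congr_fun h y

lemma norm_le_one_of_isometry_or {A : E →L[ℂ] E}
    (hA : Isometry A ∨ Isometry (ContinuousLinearMap.adjoint A)) : ‖A‖ ≤ 1 := by
  have key : ∀ B : E →L[ℂ] E, Isometry B → ‖B‖ ≤ 1 := fun B hB =>
    B.opNorm_le_bound zero_le_one fun x => by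
      rw [hB.norm_map_of_map_zero (map_zero _), one_mul]
  rcases hA with hA | hA
  · exact key A hA
  · rw [← LinearIsometryEquiv.norm_map ContinuousLinearMap.adjoint A]
    exact key _ hA

/-- An isometry or co-isometry is isometric on the orthogonal complement of its kernel. -/
lemma norm_apply_of_mem_ker_orthogonal {A : E →L[ℂ] E}
    (hA : Isometry A ∨ Isometry (ContinuousLinearMap.adjoint A)) {x : E}
    (hx : x ∈ (LinearMap.ker A.toLinearMap)ᗮ) : ‖A x‖ = ‖x‖ := by
  rcases hA with hA | hA
  · exact hA.norm_map_of_map_zero (map_zero _) x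
  · have hd : x - ContinuousLinearMap.adjoint A (A x) ∈ LinearMap.ker A.toLinearMap := by
      change A (x - ContinuousLinearMap.adjoint A (A x)) = 0
      rw [map_sub, apply_adjoint_of_isometry_adjoint hA, sub_self]
    have ho : x - ContinuousLinearMap.adjoint A (A x) ∈ (LinearMap.ker A.toLinearMap)ᗮ := by
      refine Submodule.sub_mem _ hx ((Submodule.mem_orthogonal _ _).2 fun u hu => ?_)
      rw [ContinuousLinearMap.adjoint_inner_right, show A u = 0 from hu, inner_zero_left]
    have h0 : x - ContinuousLinearMap.adjoint A (A x) = 0 :=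
      inner_self_eq_zero.1 ((Submodule.mem_orthogonal _ _).1 ho _ hd)
    rw [← hA.norm_map_of_map_zero (map_zero _) (A x), ← sub_eq_zero.1 h0]

/-- A perturbation of an isometry or co-isometry that is a contraction and does not alter the
operator on the orthogonal complement of its kernel is trivial. -/
lemma eq_zero_of_norm_sub_le_one {A B : E →L[ℂ] E}
    (hA : Isometry A ∨ Isometry (ContinuousLinearMap.adjoint A)) (hle : ‖A - B‖ ≤ 1)
    (hB : ∀ x ∈ (LinearMap.ker A.toLinearMap)ᗮ, B x = 0) : B = 0 := by
  rcases hA with hA | hA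
  · ext x
    refine hB x ((Submodule.mem_orthogonal _ _).2 fun u hu => ?_)
    have : u = 0 := hA.injective (by rw [map_zero]; exact hu)
    rw [this, inner_zero_left]
  have hker : ∀ x, A x = 0 → B x = 0 := by
    intro x hx
    have hadj : ∀ y, ContinuousLinearMap.adjoint A y ∈ (LinearMap.ker A.toLinearMap)ᗮ :=
      fun y => (Submodule.mem_orthogonal _ _).2 fun u hu => by
        rw [ContinuousLinearMap.adjoint_inner_right, show A u = 0 from hu, inner_zero_left]
    -- Test the contraction `A - B` on `x - t A* B x`: this gives `(1 + t)² ‖B x‖² ≤ ‖x‖² + t² ‖B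
    -- x‖²`. The `t²` terms cancel, leaving a left side linear in `t`.
    have hineq : ∀ t : ℝ, (1 + 2 * t) * ‖B x‖ ^ 2 ≤ ‖x‖ ^ 2 := by
      intro t
      set m := ContinuousLinearMap.adjoint A (((-t : ℝ) : ℂ) • B x) with hm
      have hAm : (A - B) (x + m) = -(((1 + t : ℝ) : ℂ) • B x) := by
        rw [sub_apply, map_add, map_add, hx, hB m (hadj _), hm,
          apply_adjoint_of_isometry_adjoint hA]
        push_cast
        module
      have hmn : ‖m‖ ^ 2 = t ^ 2 * ‖B x‖ ^ 2 := by
        rw [hm, hA.norm_map_of_map_zero (map_zero _), norm_smul, Complex.norm_real, mul_pow,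
          Real.norm_eq_abs, sq_abs, neg_sq]
      have hxm : inner ℂ x m = 0 := (Submodule.mem_orthogonal _ _).1 (hadj _) x hx
      have hp := norm_add_sq_eq_norm_sq_add_norm_sq_of_inner_eq_zero (𝕜 := ℂ) x m hxm
      have hn := (A - B).le_of_opNorm_le hle (x + m)
      rw [hAm, norm_neg, norm_smul, Complex.norm_real, one_mul, Real.norm_eq_abs] at hn
      have hsq := pow_le_pow_left₀ (by positivity) hn 2
      rw [mul_pow, sq_abs] at hsq
      nlinarith
    by_contra hne
    have hpos : 0 < ‖B x‖ ^ 2 := by positivity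
    -- For this `t` the inequality reads `‖B x‖² + 2 ‖x‖² ≤ ‖x‖²`.
    have h := hineq (‖x‖ ^ 2 / ‖B x‖ ^ 2)
    have h' : ‖x‖ ^ 2 / ‖B x‖ ^ 2 * ‖B x‖ ^ 2 = ‖x‖ ^ 2 := div_mul_cancel₀ _ hpos.ne'
    nlinarith [sq_nonneg ‖x‖]
  ext x
  have h1 : B (x - ContinuousLinearMap.adjoint A (A x)) = 0 :=
    hker _ (by rw [map_sub, apply_adjoint_of_isometry_adjoint hA, sub_self])
  have h2 : B (ContinuousLinearMap.adjoint A (A x)) = 0 :=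
    hB _ ((Submodule.mem_orthogonal _ _).2 fun u hu => by
      rw [ContinuousLinearMap.adjoint_inner_right, show A u = 0 from hu, inner_zero_left])
  rw [map_sub, h2, sub_zero] at h1
  exact h1

end Isometry

/-! ### Best approximants and the sets `Omega` -/

lemma memHInf_of_ae_eq_zero {F : OpFun} (hF : F =ᵐ[leb] 0) : MemHInf F := by
  have hent : ∀ x y : Ell2, (fun ζ => inner ℂ y (F ζ x)) =ᵐ[leb] fun _ => (0 : ℂ) := by
    intro x y
    filter_upwards [hF] with ζ h
    rw [h, Pi.zero_apply, zero_apply, inner_zero_right]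
  refine ⟨⟨fun x y => aemeasurable_const.congr (hent x y).symm, 0, ?_⟩, fun x y n _ => ?_⟩
  · filter_upwards [hF] with ζ h
    rw [h, Pi.zero_apply, norm_zero]
  · rw [fourierCoeff_congr_ae (hent x y)]
    simp [fourierCoeff]

lemma linfNorm_congr {Φ Ψ : OpFun} (h : Φ =ᵐ[leb] Ψ) : linfNorm Φ = linfNorm Ψ :=
  essSup_congr_ae (h.mono fun ζ hζ => by simp only [hζ])

lemma essSupSingularValue_congr {Φ Ψ : OpFun} (j : ℕ) (h : Φ =ᵐ[leb] Ψ) :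
    essSupSingularValue j Φ = essSupSingularValue j Ψ :=
  essSup_congr_ae (h.mono fun ζ hζ => by simp only [hζ])

lemma linfNorm_le_one {Φ : OpFun} (h : ∀ᵐ ζ ∂leb, ‖Φ ζ‖ ≤ 1) : linfNorm Φ ≤ 1 :=
  essSup_le_of_ae_le _ (h.mono fun _ hζ => ENNReal.ofReal_le_one.2 hζ)

lemma ae_norm_le_one {Φ : OpFun} (h : linfNorm Φ ≤ 1) : ∀ᵐ ζ ∂leb, ‖Φ ζ‖ ≤ 1 := by
  filter_upwards [ENNReal.ae_le_essSup (μ := leb) fun ζ => ENNReal.ofReal ‖Φ ζ‖] with ζ hζ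
  exact ENNReal.ofReal_le_one.1 (hζ.trans h)

lemma Omega_subset_Omega_zero (Φ : OpFun) : ∀ j, Omega Φ j ⊆ Omega Φ 0
  | 0 => subset_rfl
  | j + 1 => fun _ hF => Omega_subset_Omega_zero Φ j hF.1

/-- Zero is superoptimal as soon as it is the only best approximant. -/
lemma veryBadlyApproximable_of_unique {Φ : OpFun}
    (h : ∀ F : OpFun, IsBestApproximant Φ F ↔ F =ᵐ[leb] 0) : VeryBadlyApproximable Φ := by
  refine Set.mem_iInter.2 fun j => ?_
  induction j with
  | zero => exact (h 0).2 (Filter.EventuallyEq.refl _ _)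
  | succ j ih =>
    refine ⟨ih, fun G hG => (essSupSingularValue_congr _ ?_).le⟩
    have hG0 := (h G).1 (Omega_subset_Omega_zero Φ j hG)
    exact (Filter.EventuallyEq.refl _ Φ).sub hG0.symm

/-- Zero is the only bounded analytic function at distance at most one from `Φ`. -/
lemma MemHInf.ae_eq_zero_of_linfNorm_sub_le_one {Φ : OpFun} (hΦ : MemLInf Φ)
    (hiso : ∀ᵐ ζ ∂leb, Isometry (Φ ζ) ∨ Isometry (ContinuousLinearMap.adjoint (Φ ζ)))
    (hdense : HasDenseValues (LinearMap.ker (toeplitz hΦ).toLinearMap)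
      (fun ζ => (LinearMap.ker (Φ ζ).toLinearMap)ᗮ))
    {F : OpFun} (hF : MemHInf F) (hle : linfNorm (Φ - F) ≤ 1) : F =ᵐ[leb] 0 := by
  have hle' : ∀ᵐ ζ ∂leb, ‖Φ ζ - F ζ‖ ≤ 1 := ae_norm_le_one hle
  obtain ⟨hval, D, hDc, hDS, hD⟩ := hdense
  have hzero : ∀ f ∈ D, ∀ᵐ ζ ∂leb, F ζ ((f : L2) ζ) = 0 := fun f hf => by
    refine hF.apply_eq_zero_of_mem_ker hΦ hle' (hDS hf) ?_
    filter_upwards [hval f (hDS hf), hiso] with ζ h1 h2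
    exact norm_apply_of_mem_ker_orthogonal h2 h1
  -- Countability of `D` yields one null set outside which `F ζ` kills all the values; its kernel is
  -- closed, so it contains their closure.
  filter_upwards [(ae_ball_iff hDc).2 hzero, hD, hiso, hle'] with ζ h0 hcl hi hn
  refine eq_zero_of_norm_sub_le_one hi hn fun x hx => ?_
  have hsub : closure ((fun f : H2 => (f : L2) ζ) '' D) ⊆ {x | F ζ x = 0} :=
    closure_minimal (by rintro _ ⟨f, hf, rfl⟩; exact h0 f hf)
      (isClosed_eq (F ζ).continuous continuous_const)
  exact hsub (hcl hx)

end OpApprox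

theorem theorem7p2 (Φ : OpApprox.OpFun) (hΦ : OpApprox.MemLInf Φ)
    (hiso : (∀ᵐ ζ ∂OpApprox.leb, Isometry (Φ ζ)) ∨
      (∀ᵐ ζ ∂OpApprox.leb, Isometry (ContinuousLinearMap.adjoint (Φ ζ))))
    (hdense : OpApprox.HasDenseValues (LinearMap.ker (OpApprox.toeplitz hΦ).toLinearMap)
      (fun ζ => (LinearMap.ker (Φ ζ).toLinearMap)ᗮ)) :
    OpApprox.VeryBadlyApproximable Φ ∧
      ∀ F : OpApprox.OpFun, OpApprox.IsBestApproximant Φ F ↔ F =ᵐ[OpApprox.leb] 0 := by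
  have hiso' : ∀ᵐ ζ ∂OpApprox.leb,
      Isometry (Φ ζ) ∨ Isometry (ContinuousLinearMap.adjoint (Φ ζ)) := by
    rcases hiso with h | h
    · exact h.mono fun _ => Or.inl
    · exact h.mono fun _ => Or.inr
  have hΦ1 : OpApprox.linfNorm Φ ≤ 1 :=
    OpApprox.linfNorm_le_one (hiso'.mono fun _ => OpApprox.norm_le_one_of_isometry_or)
  have hsub : ∀ F : OpApprox.OpFun, F =ᵐ[OpApprox.leb] 0 →
      OpApprox.linfNorm (Φ - F) = OpApprox.linfNorm Φ := fun F hF => by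
    refine OpApprox.linfNorm_congr (hF.mono fun ζ h => ?_)
    rw [Pi.sub_apply, h, Pi.zero_apply, sub_zero]
  have huniq : ∀ F : OpApprox.OpFun, OpApprox.IsBestApproximant Φ F ↔ F =ᵐ[OpApprox.leb] 0 := by
    refine fun F => ⟨fun hF => ?_, fun hF => ⟨OpApprox.memHInf_of_ae_eq_zero hF, fun G hG => ?_⟩⟩
    · refine hF.1.ae_eq_zero_of_linfNorm_sub_le_one hΦ hiso' hdense ?_
      have h := hF.2 0 (OpApprox.memHInf_of_ae_eq_zero (Filter.EventuallyEq.refl _ _))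
      rw [sub_zero] at h
      exact h.trans hΦ1
    · rw [hsub F hF]
      -- A competitor at least as close as zero is within distance one, hence vanishes a.e. and is
      -- no closer.
      rcases le_total (OpApprox.linfNorm Φ) (OpApprox.linfNorm (Φ - G)) with h | h
      · exact h
      · exact (hsub G
          (hG.ae_eq_zero_of_linfNorm_sub_le_one hΦ hiso' hdense (h.trans hΦ1))).ge
  exact ⟨OpApprox.veryBadlyApproximable_of_unique huniq, huniq⟩
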